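/- All manifolds and maps are smooth, and all vector spaces are real and finite-dimensional. A *Pfaffian group* $(G,\omega,V)$ (a Pfaffian groupoid over a point) consists of a Lie group $G$, a representation $V$ of $G$ and a one-form $\omega\in\Omega^1(G,V)$ of constant rank, with $\ker\omega$ involutive, which is multiplicative: writing $m:G\times G\to G$ for the multiplication, \[ (m^*\omega)_{(g,h)}=(\mathrm{pr}_1^*\omega)_{(g,h)}+g\cdot(\mathrm{pr}_2^*\omega)_{(g,h)},\qquad g,h\in G . \] A *morphism* $(G_1,\omega_1,V_1)\to(G_2,\omega_2,V_2)$ is a pair $(\Phi,\Psi)$ of a Lie group morphism $\Phi:G_1\to G_2$ and a linear map $\Psi:V_1\to V_2$ with $\Psi(g\cdot\alpha)=\Phi(g)\cdot\Psi(\alpha)$ and $\Phi^*\omega_2=\Psi\circ\omega_1$. Two Pfaffian groups are *Pfaffian isomorphic* if there are mutually inverse morphisms between them. A *principal Pfaffian bibundle* between $(G_1,\omega_1,V_1)$ and $(G_2,\omega_2,V_2)$ is a non-empty Hausdorff manifold $P$ with commuting smooth actions of $G_1$ from the left and of $G_2$ from the right, a one-form $\theta\in\Omega^1(P,V_1)$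 and a smooth isomorphism of vector bundles $\Phi:P\times V_1\to P\times V_2$ over $\mathrm{id}_P$, with fibre maps $\Phi_p:V_1\to V_2$, such that - each of the two actions is free, transitive and proper (i.e. $(g,p)\mapsto(g\cdot p,p)$ and $(p,h)\mapsto(p\cdot h,p)$ are proper maps); - writing $m_1:G_1\times P\to P$ and $m_2:P\times G_2\to P$ for the actions, $(m_1^*\theta)_{(g,p)}=(\mathrm{pr}_1^*\omega_1)_{(g,p)}+g\cdot(\mathrm{pr}_2^*\theta)_{(g,p)}$ for all $g\in G_1$, $p\in P$, and $\bigl(m_2^*(\Phi\circ\theta)\bigr)_{(p,h)}=h^{-1}\cdot\bigl(\mathrm{pr}_1^*(\Phi\circ\theta)\bigr)_{(p,h)}+h^{-1}\cdot(\mathrm{pr}_2^*\omega_2)_{(p,h)}$ for all $p\in P$, $h\in G_2$; - $\Phi_{g\cdot p}(g\cdot\alpha)=\Phi_p(\alpha)$ and $\Phi_{p\cdot h}(\alpha)=h^{-1}\cdot\Phi_p(\alpha)$ for all $g\in G_1$, $h\in G_2$, $p\in P$, $\alpha\in V_1$. Two Pfaffian groups are *Pfaffian Morita equivalent* if there exists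 a principal Pfaffian bibundle between them. **Corollary.** Two Pfaffian groups $(G_1,\omega_1,V_1)$ and $(G_2,\omega_2,V_2)$ are Pfaffian Morita equivalent if and only if they are Pfaffian isomorphic. -/

import Mathlib

open scoped Manifold ContDiff

universe u v

noncomputable section

namespace Pfaffian

/-- A smooth one-form on the manifold `M` (modelled on `E`) with values in the vector space `V`:
a family of linear maps `T_x M → V` that is smooth as a map `TM → V`. -/
structure OneForm (E M V : Type*)
    [NormedAddCommGroup E] [NormedSpace ℝ E]
    [TopologicalSpace M] [ChartedSpace E M] [IsManifold 𝓘(ℝ, E) ∞ M]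
    [NormedAddCommGroup V] [NormedSpace ℝ V] where
  /-- the value of the form at a point -/
  toFun : ∀ x : M, TangentSpace 𝓘(ℝ, E) x →L[ℝ] V
  smooth : ContMDiff 𝓘(ℝ, E).tangent 𝓘(ℝ, V) ∞
    (fun X : TangentBundle 𝓘(ℝ, E) M => toFun X.proj X.2)

/-- A field of tangent subspaces is involutive if the bracket of any two local smooth sections,
defined over an open set, is again a section over that set. -/
def Involutive {E M : Type*} [NormedAddCommGroup E] [NormedSpace ℝ E]
    [TopologicalSpace M] [ChartedSpace E M] [IsManifold 𝓘(ℝ, E) ∞ M]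
    (D : ∀ x : M, Submodule ℝ (TangentSpace 𝓘(ℝ, E) x)) : Prop :=
  ∀ (U : Set M), IsOpen U → ∀ X Y : (∀ x : M, TangentSpace 𝓘(ℝ, E) x),
    ContMDiffOn 𝓘(ℝ, E) 𝓘(ℝ, E).tangent ∞
      (fun x => (⟨x, X x⟩ : TangentBundle 𝓘(ℝ, E) M)) U →
    ContMDiffOn 𝓘(ℝ, E) 𝓘(ℝ, E).tangent ∞
      (fun x => (⟨x, Y x⟩ : TangentBundle 𝓘(ℝ, E) M)) U →
    (∀ x ∈ U, X x ∈ D x) → (∀ x ∈ U, Y x ∈ D x) →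
    ∀ x ∈ U, VectorField.mlieBracket 𝓘(ℝ, E) X Y x ∈ D x

/-- A Pfaffian group `(G, ω, V)`, that is, a Pfaffian groupoid over a point: a representation `V`
of the Lie group `G` and a one-form `ω ∈ Ω¹(G, V)` that is multiplicative, has constant rank and
has an involutive symbol bundle.

Over a point the source and target maps are constant, so `ker ds = ker dt = TG`: the symbol bundle
`ker ω ∩ ker ds` is `ker ω`, and the conditions `TG = ker ω + ker ds` and
`ker ω ∩ ker dt = ker ω ∩ ker ds` hold for every form. -/
structure PfaffianGroup (E G V : Type*)
    [NormedAddCommGroup E] [NormedSpace ℝ E]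
    [TopologicalSpace G] [ChartedSpace E G] [Group G] [LieGroup 𝓘(ℝ, E) ∞ G]
    [NormedAddCommGroup V] [NormedSpace ℝ V] where
  /-- the representation of `G` on `V` -/
  rep : Representation ℝ G V
  smooth_rep : ContMDiff (𝓘(ℝ, E).prod 𝓘(ℝ, V)) 𝓘(ℝ, V) ∞ (fun x : G × V => rep x.1 x.2)
  /-- the Pfaffian form -/
  form : OneForm E G V
  /-- `m^* ω = pr₁^* ω + g · pr₂^* ω` at `(g, h)` -/
  multiplicative : ∀ (g h : G) (v : TangentSpace 𝓘(ℝ, E) g) (w : TangentSpace 𝓘(ℝ, E) h),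
    form.toFun (g * h)
      (mfderiv (𝓘(ℝ, E).prod 𝓘(ℝ, E)) 𝓘(ℝ, E) (fun x : G × G => x.1 * x.2) (g, h) (v, w))
      = form.toFun g v + rep g (form.toFun h w)
  constant_rank : ∃ r : ℕ, ∀ g : G, Module.finrank ℝ (form.toFun g).range = r
  involutive : Involutive (fun g : G => (form.toFun g).ker)

section Morphisms

variable {E₁ G₁ V₁ E₂ G₂ V₂ : Type*}
  [NormedAddCommGroup E₁] [NormedSpace ℝ E₁]
  [TopologicalSpace G₁] [ChartedSpace E₁ G₁] [Group G₁] [LieGroup 𝓘(ℝ, E₁) ∞ G₁]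
  [NormedAddCommGroup V₁] [NormedSpace ℝ V₁]
  [NormedAddCommGroup E₂] [NormedSpace ℝ E₂]
  [TopologicalSpace G₂] [ChartedSpace E₂ G₂] [Group G₂] [LieGroup 𝓘(ℝ, E₂) ∞ G₂]
  [NormedAddCommGroup V₂] [NormedSpace ℝ V₂]

/-- A morphism of Pfaffian groups: a morphism of Lie groups `Φ` and a morphism of representations
`Ψ` along it, with `Φ^* ω₂ = Ψ ∘ ω₁`. -/
structure PfaffianGroup.Hom (A : PfaffianGroup E₁ G₁ V₁) (B : PfaffianGroup E₂ G₂ V₂) where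
  /-- the morphism of Lie groups -/
  onGroup : G₁ →* G₂
  smooth_onGroup : ContMDiff 𝓘(ℝ, E₁) 𝓘(ℝ, E₂) ∞ onGroup
  /-- the morphism of representations -/
  onRep : V₁ →ₗ[ℝ] V₂
  equivariant : ∀ (g : G₁) (α : V₁), onRep (A.rep g α) = B.rep (onGroup g) (onRep α)
  pullback_form : ∀ (g : G₁) (v : TangentSpace 𝓘(ℝ, E₁) g),
    B.form.toFun (onGroup g) (mfderiv 𝓘(ℝ, E₁) 𝓘(ℝ, E₂) onGroup g v) = onRep (A.form.toFun g v)

/-- Two Pfaffian groups are Pfaffian isomorphic if there are mutually inverse morphisms of Pfaffian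
groups between them. -/
def PfaffianIsomorphic (A : PfaffianGroup E₁ G₁ V₁) (B : PfaffianGroup E₂ G₂ V₂) : Prop :=
  ∃ (f : A.Hom B) (f' : B.Hom A),
    (∀ g, f'.onGroup (f.onGroup g) = g) ∧ (∀ h, f.onGroup (f'.onGroup h) = h) ∧
    (∀ α, f'.onRep (f.onRep α) = α) ∧ (∀ β, f.onRep (f'.onRep β) = β)

end Morphisms

section Bundles

variable {E G V F P : Type*}
  [NormedAddCommGroup E] [NormedSpace ℝ E]
  [TopologicalSpace G] [ChartedSpace E G] [Group G] [LieGroup 𝓘(ℝ, E) ∞ G]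
  [NormedAddCommGroup V] [NormedSpace ℝ V]
  [NormedAddCommGroup F] [NormedSpace ℝ F]
  [TopologicalSpace P] [ChartedSpace F P] [IsManifold 𝓘(ℝ, F) ∞ P]

/-- `(P, θ)` is a left principal `(G, ω, V)`-bundle over a point: the action of `G` on `P` is
smooth, transitive on the (unique) fibre of `P → pt`, free and proper, `P → pt` is surjective, and
`θ` is multiplicative.

The projection `π` and the moment map `μ` are the constant map `P → pt`; they are submersions,
`π` is invariant, and `ker dμ ∩ ker θ = ker dπ ∩ ker θ` because `ker dμ = ker dπ = TP`. -/
structure IsLeftPrincipalBundle (A : PfaffianGroup E G V) [MulAction G P]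
    (θ : OneForm F P V) : Prop where
  nonempty : Nonempty P
  smooth_action : ContMDiff (𝓘(ℝ, E).prod 𝓘(ℝ, F)) 𝓘(ℝ, F) ∞ (fun x : G × P => x.1 • x.2)
  transitive : ∀ p q : P, ∃ g : G, q = g • p
  free : ∀ (g : G) (p : P), g • p = p → g = 1
  proper : IsProperMap (fun x : G × P => (x.1 • x.2, x.2))
  /-- `m_P^* θ = pr₁^* ω + g · pr₂^* θ` at `(g, p)` -/
  multiplicative : ∀ (g : G) (p : P) (v : TangentSpace 𝓘(ℝ, E) g) (w : TangentSpace 𝓘(ℝ, F) p),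
    θ.toFun (g • p)
      (mfderiv (𝓘(ℝ, E).prod 𝓘(ℝ, F)) 𝓘(ℝ, F) (fun x : G × P => x.1 • x.2) (g, p) (v, w))
      = A.form.toFun g v + A.rep g (θ.toFun p w)

/-- `(P, η)` is a right principal `(G, ω, V)`-bundle over a point. The right action
`p · g` is `MulOpposite.op g • p`. -/
structure IsRightPrincipalBundle (A : PfaffianGroup E G V) [MulAction Gᵐᵒᵖ P]
    (η : OneForm F P V) : Prop where
  nonempty : Nonempty P
  smooth_action : ContMDiff (𝓘(ℝ, F).prod 𝓘(ℝ, E)) 𝓘(ℝ, F) ∞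
    (fun x : P × G => MulOpposite.op x.2 • x.1)
  transitive : ∀ p q : P, ∃ g : G, q = MulOpposite.op g • p
  free : ∀ (p : P) (g : G), MulOpposite.op g • p = p → g = 1
  proper : IsProperMap (fun x : P × G => (MulOpposite.op x.2 • x.1, x.1))
  /-- `m_P^* η = g⁻¹ · pr₁^* η + g⁻¹ · pr₂^* ω` at `(p, g)` -/
  multiplicative : ∀ (p : P) (g : G) (w : TangentSpace 𝓘(ℝ, F) p) (v : TangentSpace 𝓘(ℝ, E) g),
    η.toFun (MulOpposite.op g • p)
      (mfderiv (𝓘(ℝ, F).prod 𝓘(ℝ, E)) 𝓘(ℝ, F)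
        (fun x : P × G => MulOpposite.op x.2 • x.1) (p, g) (w, v))
      = A.rep g⁻¹ (η.toFun p w) + A.rep g⁻¹ (A.form.toFun g v)

end Bundles

section Bibundles

variable {F P V₁ V₂ : Type*}
  [NormedAddCommGroup F] [NormedSpace ℝ F]
  [TopologicalSpace P] [ChartedSpace F P] [IsManifold 𝓘(ℝ, F) ∞ P]
  [NormedAddCommGroup V₁] [NormedSpace ℝ V₁] [FiniteDimensional ℝ V₁]
  [NormedAddCommGroup V₂] [NormedSpace ℝ V₂]

/-- A smooth isomorphism over the identity between the trivial vector bundles `P × V₁` and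
`P × V₂`, which are the pullbacks of `V₁ → pt` and `V₂ → pt` to `P`. -/
structure TrivialBundleIso (F P V₁ V₂ : Type*)
    [NormedAddCommGroup F] [NormedSpace ℝ F] [TopologicalSpace P] [ChartedSpace F P]
    [NormedAddCommGroup V₁] [NormedSpace ℝ V₁]
    [NormedAddCommGroup V₂] [NormedSpace ℝ V₂] where
  /-- the isomorphism on the fibres over a point -/
  toFun : P → V₁ ≃ₗ[ℝ] V₂
  smooth : ContMDiff (𝓘(ℝ, F).prod 𝓘(ℝ, V₁)) 𝓘(ℝ, V₂) ∞ (fun x : P × V₁ => toFun x.1 x.2)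

/-- The form `Φ ∘ θ`. -/
def TrivialBundleIso.compForm (Φ : TrivialBundleIso F P V₁ V₂) (θ : OneForm F P V₁) :
    OneForm F P V₂ where
  toFun p := (LinearMap.toContinuousLinearMap (Φ.toFun p).toLinearMap).comp (θ.toFun p)
  smooth := Φ.smooth.comp ((Bundle.contMDiff_proj _).prodMk θ.smooth)

variable {E₁ G₁ E₂ G₂ : Type*}
  [NormedAddCommGroup E₁] [NormedSpace ℝ E₁]
  [TopologicalSpace G₁] [ChartedSpace E₁ G₁] [Group G₁] [LieGroup 𝓘(ℝ, E₁) ∞ G₁]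
  [NormedAddCommGroup E₂] [NormedSpace ℝ E₂]
  [TopologicalSpace G₂] [ChartedSpace E₂ G₂] [Group G₂] [LieGroup 𝓘(ℝ, E₂) ∞ G₂]

/-- `(P, θ, Φ)` is a principal Pfaffian bibundle between two Pfaffian groups. The last two fields
say that `Φ` is a morphism of `G₁ ⋉ P`-representations, with `P × V₂` carrying the trivial one, and
a morphism of right `P ⋊ G₂`-representations, with `P × V₁` carrying the trivial one. -/
structure IsPrincipalBibundle (A : PfaffianGroup E₁ G₁ V₁) (B : PfaffianGroup E₂ G₂ V₂)
    [MulAction G₁ P] [MulAction G₂ᵐᵒᵖ P]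
    (θ : OneForm F P V₁) (Φ : TrivialBundleIso F P V₁ V₂) : Prop where
  left : IsLeftPrincipalBundle A θ
  right : IsRightPrincipalBundle B (Φ.compForm θ)
  commute : ∀ (g : G₁) (h : G₂) (p : P),
    MulOpposite.op h • (g • p) = g • (MulOpposite.op h • p)
  left_equivariant : ∀ (g : G₁) (p : P) (α : V₁),
    Φ.toFun (g • p) (A.rep g α) = Φ.toFun p α
  right_equivariant : ∀ (p : P) (h : G₂) (α : V₁),
    Φ.toFun (MulOpposite.op h • p) α = B.rep h⁻¹ (Φ.toFun p α)

end Bibundles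



/-- Two Pfaffian groups are Pfaffian Morita equivalent if there is a principal Pfaffian bibundle
`(P, θ, Φ)` between them, on some Hausdorff finite-dimensional smooth manifold `P`. -/
def PfaffianMoritaEquivalent {E₁ E₂ : Type u} {G₁ G₂ : Type v} {V₁ V₂ : Type*}
    [NormedAddCommGroup E₁] [NormedSpace ℝ E₁]
    [TopologicalSpace G₁] [ChartedSpace E₁ G₁] [Group G₁] [LieGroup 𝓘(ℝ, E₁) ∞ G₁]
    [NormedAddCommGroup V₁] [NormedSpace ℝ V₁] [FiniteDimensional ℝ V₁]
    [NormedAddCommGroup E₂] [NormedSpace ℝ E₂]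
    [TopologicalSpace G₂] [ChartedSpace E₂ G₂] [Group G₂] [LieGroup 𝓘(ℝ, E₂) ∞ G₂]
    [NormedAddCommGroup V₂] [NormedSpace ℝ V₂]
    (A : PfaffianGroup E₁ G₁ V₁) (B : PfaffianGroup E₂ G₂ V₂) : Prop :=
  ∃ (F : Type u) (_ : NormedAddCommGroup F) (_ : NormedSpace ℝ F) (_ : FiniteDimensional ℝ F)
    (P : Type v) (_ : TopologicalSpace P) (_ : T2Space P)
    (_ : ChartedSpace F P) (_ : IsManifold 𝓘(ℝ, F) ∞ P)
    (_ : MulAction G₁ P) (_ : MulAction G₂ᵐᵒᵖ P)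
    (θ : OneForm F P V₁) (Φ : TrivialBundleIso F P V₁ V₂), IsPrincipalBibundle A B θ Φ

end Pfaffian

end

/-!
Fix a point `p` of a bibundle `(P, θ, Φ)`. Both orbit maps `g ↦ g · p` and `h ↦ p · h` are
diffeomorphisms onto `P`, so `g · p = p · φ(g)` defines a diffeomorphism `φ : G₁ → G₂`, which is a
homomorphism because the actions commute. Multiplicativity says that `θ` pulls back to `ω₁` along
the orbit map of `G₁` and that `Φ ∘ θ` pulls back to `h⁻¹ · ω₂` along that of `G₂`; comparing the
two through `φ` shows that `(φ, Φ_p)` is an isomorphism of Pfaffian groups.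

An orbit map is a homeomorphism because the action is free, transitive and proper. It is an
immersion because a vector in the kernel of its differential spreads, by equivariance, to a
left-invariant vector field in the kernel, whose integral curves the orbit map contracts to points,
against injectivity. The inverse is then smooth by the inverse function theorem, once the two
dimensions are seen to agree: they do because a `C¹` map does not raise Hausdorff dimension.

Conversely, for an isomorphism `(φ, Ψ)` take `P = G₁` and `θ = ω₁`, with `G₁` acting by left
multiplication, `G₂` by right multiplication through `φ⁻¹`, and fibre maps `α ↦ Ψ(p⁻¹ · α)`.
-/

section InverseFunction

open Module

variable {E F : Type*} [NormedAddCommGroup E] [NormedSpace ℝ E] [FiniteDimensional ℝ E]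
  [NormedAddCommGroup F] [NormedSpace ℝ F] [FiniteDimensional ℝ F]

theorem finrank_le_of_nonempty_interior_image {f : E → F} {s : Set E} (hs : Convex ℝ s)
    (hf : ContDiffOn ℝ 1 f s) (hfs : (interior (f '' s)).Nonempty) :
    finrank ℝ F ≤ finrank ℝ E := by
  have hdim : dimH (f '' s) ≤ dimH (Set.univ : Set E) :=
    (hf.dimH_image_le hs subset_rfl).trans (dimH_mono (Set.subset_univ s))
  rw [Real.dimH_of_nonempty_interior hfs, Real.dimH_univ_eq_finrank] at hdim
  exact_mod_cast hdim

theorem finrank_le_of_contDiffOn_openPartialHomeomorph (c : OpenPartialHomeomorph E F)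
    (hc : ContDiffOn ℝ 1 c c.source) (hne : c.source.Nonempty) :
    finrank ℝ F ≤ finrank ℝ E := by
  obtain ⟨a, ha⟩ := hne
  obtain ⟨ε, hε, hball⟩ := Metric.isOpen_iff.1 c.open_source a ha
  have hopen : IsOpen (c '' Metric.ball a ε) :=
    c.isOpen_image_of_subset_source Metric.isOpen_ball hball
  refine finrank_le_of_nonempty_interior_image (convex_ball a ε) (hc.mono hball) ?_
  rw [hopen.interior_eq]
  exact (Metric.nonempty_ball.2 hε).image c

theorem contDiffAt_symm_of_injective_fderiv {n : ℕ∞ω} (hn : n ≠ 0)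
    (c : OpenPartialHomeomorph E F) (hc : ContDiffOn ℝ n c c.source) {a : E} (ha : a ∈ c.source)
    (hinj : Function.Injective (fderiv ℝ c a)) : ContDiffAt ℝ n c.symm (c a) := by
  have hca : ContDiffAt ℝ n c a := hc.contDiffAt (c.open_source.mem_nhds ha)
  have hdim : finrank ℝ E = finrank ℝ F :=
    le_antisymm (LinearMap.finrank_le_finrank_of_injective (f := (fderiv ℝ c a).toLinearMap) hinj)
      (finrank_le_of_contDiffOn_openPartialHomeomorph c
        (hc.of_le (ENat.one_le_iff_ne_zero_withTop.2 hn)) ⟨a, ha⟩)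
  let L : E ≃L[ℝ] F := (LinearEquiv.ofInjectiveOfFinrankEq
    (fderiv ℝ c a).toLinearMap hinj hdim).toContinuousLinearEquiv
  have hL : HasFDerivAt c (L : E →L[ℝ] F) a := (hca.differentiableAt hn).hasFDerivAt
  rw [← c.left_inv ha] at hL hca
  exact c.contDiffAt_symm (c.map_source ha) hL hca

variable {M N : Type*} [TopologicalSpace M] [ChartedSpace E M] [TopologicalSpace N]
  [ChartedSpace F N] {n : ℕ∞ω} [IsManifold 𝓘(ℝ, E) n M] [IsManifold 𝓘(ℝ, F) n N]

theorem contMDiff_symm_of_injective_mfderiv (hn : n ≠ 0) (e : M ≃ₜ N)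
    (he : ContMDiff 𝓘(ℝ, E) 𝓘(ℝ, F) n e)
    (hinj : ∀ x, Function.Injective (mfderiv 𝓘(ℝ, E) 𝓘(ℝ, F) e x)) :
    ContMDiff 𝓘(ℝ, F) 𝓘(ℝ, E) n e.symm := by
  intro y
  obtain ⟨x, rfl⟩ := e.surjective y
  let c : OpenPartialHomeomorph E F :=
    (chartAt E x).symm.trans (e.toOpenPartialHomeomorph.trans (chartAt F (e x)))
  have hx : chartAt E x x ∈ c.source := by simp [c]
  have hcx : c (chartAt E x x) = chartAt F (e x) (e x) := by simp [c]
  have hc : ContDiffOn ℝ n c c.source := by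
    rw [← contMDiffOn_iff_contDiffOn]
    have hsource : c.source ⊆ (chartAt E x).target := fun z hz => hz.1
    have hmaps : Set.MapsTo (e ∘ (chartAt E x).symm) c.source (chartAt F (e x)).source :=
      fun z hz => hz.2.2
    exact contMDiffOn_chart.comp
      (he.comp_contMDiffOn (contMDiffOn_chart_symm.mono hsource)) hmaps
  have hfderiv : fderiv ℝ c (chartAt E x x) = mfderiv 𝓘(ℝ, E) 𝓘(ℝ, F) e x := by
    rw [(he.mdifferentiableAt hn).mfderiv, ModelWithCorners.range_eq_univ, fderivWithin_univ]
    rfl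
  rw [contMDiffAt_iff, ModelWithCorners.range_eq_univ, contDiffWithinAt_univ]
  refine ⟨e.symm.continuous.continuousAt, ?_⟩
  have hsymm := contDiffAt_symm_of_injective_fderiv hn c hc hx (hfderiv ▸ hinj x)
  rw [hcx] at hsymm
  rw [e.symm_apply_apply]
  exact hsymm

end InverseFunction

section Immersion

open Filter Topology

variable {E H F K : Type*} [NormedAddCommGroup E] [NormedSpace ℝ E] [TopologicalSpace H]
  {I : ModelWithCorners ℝ E H} [NormedAddCommGroup F] [NormedSpace ℝ F] [TopologicalSpace K]
  {J : ModelWithCorners ℝ F K}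

section VectorField

variable {M N : Type*} [TopologicalSpace M] [ChartedSpace H M] [TopologicalSpace N]
  [ChartedSpace K N] {f : M → N} {γ : ℝ → M} {t₀ : ℝ} {X : ∀ x : M, TangentSpace I x}

theorem apply_eq_zero_of_isMIntegralCurveAt_of_eventuallyEq_const {x : M}
    (hγ : IsMIntegralCurveAt γ X t₀) (hconst : γ =ᶠ[𝓝 t₀] fun _ => x) : X x = 0 := by
  obtain rfl : γ t₀ = x := hconst.self_of_nhds
  have hderiv := hγ.hasMFDerivAt.mfderiv
  rw [hconst.mfderiv_eq, mfderiv_const] at hderiv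
  exact (one_smul ℝ (X (γ t₀))).symm.trans (DFunLike.congr_fun hderiv (1 : ℝ)).symm

variable [IsManifold J 1 N] [BoundarylessManifold J N]

theorem comp_eventuallyEq_const_of_mfderiv_apply_eq_zero (hf : MDifferentiable I J f)
    (hfX : ∀ x, mfderiv I J f x (X x) = 0) (hγ : IsMIntegralCurveAt γ X t₀) :
    f ∘ γ =ᶠ[𝓝 t₀] fun _ => f (γ t₀) := by
  have hcomp : IsMIntegralCurveAt (f ∘ γ) (fun y : N => (0 : TangentSpace J y)) t₀ := by
    filter_upwards [hγ] with t ht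
    refine ((hf (γ t)).hasMFDerivAt.comp t ht).congr_mfderiv
      (ContinuousLinearMap.ext fun (s : ℝ) => ?_)
    change mfderiv I J f (γ t) (s • X (γ t)) = s • (0 : TangentSpace J (f (γ t)))
    rw [map_smul, hfX]
  have hconst : IsMIntegralCurveAt (fun _ => f (γ t₀)) (fun y : N => (0 : TangentSpace J y)) t₀ :=
    .of_forall fun t => (hasMFDerivAt_const (f (γ t₀)) t).congr_mfderiv
      (ContinuousLinearMap.ext fun (s : ℝ) => (smul_zero s).symm)
  exact isMIntegralCurveAt_eventuallyEq_of_contMDiffAt_boundaryless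
    (Bundle.contMDiff_zeroSection ℝ (TangentSpace J : N → Type _)).contMDiffAt hcomp hconst rfl

theorem eq_zero_of_injective_of_mfderiv_apply_eq_zero [CompleteSpace E] [IsManifold I 1 M]
    [BoundarylessManifold I M] (hf : MDifferentiable I J f) (hinj : Function.Injective f)
    {x : M} (hX : ContMDiffAt I I.tangent 1 (fun y => (⟨y, X y⟩ : TangentBundle I M)) x)
    (hfX : ∀ y, mfderiv I J f y (X y) = 0) : X x = 0 := by
  obtain ⟨γ, rfl, hγ⟩ := exists_isMIntegralCurveAt_of_contMDiffAt_boundaryless 0 hX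
  exact apply_eq_zero_of_isMIntegralCurveAt_of_eventuallyEq_const hγ
    ((comp_eventuallyEq_const_of_mfderiv_apply_eq_zero hf hfX hγ).mono fun _ ht => hinj ht)

end VectorField

section Equivariant

variable {G P : Type*} [TopologicalSpace G] [ChartedSpace H G] [Group G] [LieGroup I 3 G]
  [TopologicalSpace P] [ChartedSpace K P] [SMul G P] {f : G → P}

theorem mfderiv_mul_left_apply_eq_zero (hf : MDifferentiable I J f)
    (hsmul : ∀ g : G, MDifferentiable J J fun p : P => g • p)
    (hequiv : ∀ g h : G, f (g * h) = g • f h) {g h k : G} (hk : g * h = k)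
    {v : TangentSpace I h} (hv : mfderiv I J f h v = 0) :
    mfderiv I J f k (mfderiv I I (g * ·) h v) = 0 := by
  have hmul : MDifferentiableAt I I (g * ·) h :=
    (contMDiff_mul_left (I := I) (n := 3)).mdifferentiableAt (by simp)
  rw [← mfderiv_comp_apply_of_eq h (hf k) hmul hk,
    show f ∘ (g * ·) = (g • ·) ∘ f from funext (hequiv g),
    mfderiv_comp_apply h (hsmul g (f h)) (hf h), hv]
  exact map_zero _

theorem injective_mfderiv_mul_left (g h : G) : Function.Injective (mfderiv I I (g * ·) h) :=
  ((Diffeomorph.smul I I 3 g).mfderivToContinuousLinearEquiv (by norm_num) h).injective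

theorem injective_mfderiv_of_injective_of_equivariant [CompleteSpace E]
    [BoundarylessManifold I G] [IsManifold J 1 P] [BoundarylessManifold J P]
    (hf : MDifferentiable I J f) (hinj : Function.Injective f)
    (hsmul : ∀ g : G, MDifferentiable J J fun p : P => g • p)
    (hequiv : ∀ g h : G, f (g * h) = g • f h) (x : G) :
    Function.Injective (mfderiv I J f x) := by
  have : LieGroup I (minSmoothness ℝ 3) G := by
    rwa [minSmoothness_of_isRCLikeNormedField]
  have : IsManifold I 1 G := .of_le (n := 3) (by norm_num)
  rw [injective_iff_map_eq_zero]
  intro v hv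
  set u : GroupLieAlgebra I G := mfderiv I I (x⁻¹ * ·) x v
  have hu : mfderiv I J f 1 u = 0 :=
    mfderiv_mul_left_apply_eq_zero hf hsmul hequiv (inv_mul_cancel x) hv
  have hX : mulInvariantVectorField u (1 : G) = 0 := by
    refine eq_zero_of_injective_of_mfderiv_apply_eq_zero hf hinj
      ((contMDiffAt_mulInvariantVectorField u).of_le ?_) fun g =>
        mfderiv_mul_left_apply_eq_zero hf hsmul hequiv (mul_one g) hu
    rw [minSmoothness_of_isRCLikeNormedField]
    norm_num
  have hu_zero : u = 0 := (injective_mfderiv_mul_left 1 1) (hX.trans (map_zero _).symm)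
  exact injective_mfderiv_mul_left x⁻¹ x (hu_zero.trans (map_zero _).symm)

end Equivariant

end Immersion

section Orbit

theorem isClosedMap_smul_const {G P : Type*} [TopologicalSpace G] [Group G] [TopologicalSpace P]
    [MulAction G P] [ProperSMul G P] (p : P) : IsClosedMap fun g : G => g • p := by
  intro C hC
  have hclosed : IsClosed ((fun x : G × P => (x.1 • x.2, x.2)) '' C ×ˢ Set.univ) :=
    ProperSMul.isProperMap_smul_pair.isClosedMap _ (hC.prod isClosed_univ)
  convert hclosed.preimage (Continuous.prodMk_left p) using 1
  ext q
  simp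

variable {E G F P : Type*} [NormedAddCommGroup E] [NormedSpace ℝ E]
  [TopologicalSpace G] [ChartedSpace E G] [Group G] [LieGroup 𝓘(ℝ, E) ∞ G]
  [NormedAddCommGroup F] [NormedSpace ℝ F] [FiniteDimensional ℝ F]
  [TopologicalSpace P] [ChartedSpace F P] [IsManifold 𝓘(ℝ, F) ∞ P]

theorem exists_diffeomorph_eq_smul_const [MulAction G P] [ContMDiffSMul 𝓘(ℝ, E) 𝓘(ℝ, F) ∞ G P]
    [ProperSMul G P] [MulAction.IsPretransitive G P] [IsCancelSMul G P] (p : P) :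
    ∃ e : G ≃ₘ⟮𝓘(ℝ, E), 𝓘(ℝ, F)⟯ P, ∀ g, e g = g • p := by
  have horbit : ContMDiff 𝓘(ℝ, E) 𝓘(ℝ, F) ∞ fun g : G => g • p :=
    contMDiff_id.smul (I := 𝓘(ℝ, E)) contMDiff_const
  have hinj : Function.Injective fun g : G => g • p := fun g g' => IsCancelSMul.right_cancel g g' p
  let e : G ≃ₜ P := (Equiv.ofBijective _ ⟨hinj, MulAction.surjective_smul G p⟩)
    |>.toHomeomorphOfContinuousClosed horbit.continuous (isClosedMap_smul_const p)
  have : LocallyCompactSpace P := Manifold.locallyCompact_of_finiteDimensional 𝓘(ℝ, F)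
  have : LocallyCompactSpace G := e.isClosedEmbedding.locallyCompactSpace
  have : FiniteDimensional ℝ E := .of_locallyCompact_manifold G 𝓘(ℝ, E)
  have : CompleteSpace E := FiniteDimensional.complete ℝ E
  have himmersion : ∀ g, Function.Injective (mfderiv 𝓘(ℝ, E) 𝓘(ℝ, F) e g) :=
    injective_mfderiv_of_injective_of_equivariant (horbit.mdifferentiable (by simp)) hinj
      (fun g => (ContMDiffSMul.contMDiff_const_smul (I := 𝓘(ℝ, E)) (n := ∞) g).mdifferentiable
        (by simp)) fun g h => mul_smul g h p
  exact ⟨⟨e.toEquiv, horbit, contMDiff_symm_of_injective_mfderiv (by simp) e horbit himmersion⟩,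
    fun _ => rfl⟩

end Orbit

namespace Pfaffian

section Pullback

variable {E M E' M' H H' F P V : Type*}
  [NormedAddCommGroup E] [NormedSpace ℝ E] [TopologicalSpace H] {I : ModelWithCorners ℝ E H}
  [TopologicalSpace M] [ChartedSpace H M]
  [NormedAddCommGroup E'] [NormedSpace ℝ E'] [TopologicalSpace H'] {I' : ModelWithCorners ℝ E' H'}
  [TopologicalSpace M'] [ChartedSpace H' M']
  [NormedAddCommGroup F] [NormedSpace ℝ F]
  [TopologicalSpace P] [ChartedSpace F P] [IsManifold 𝓘(ℝ, F) ∞ P]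
  [NormedAddCommGroup V] [NormedSpace ℝ V]

/-- The pullback `f^* η` of a one-form, as a family of linear maps on tangent spaces. It is `0` at
points where `f` is not differentiable. -/
noncomputable def OneForm.pullback (η : OneForm F P V) (I : ModelWithCorners ℝ E H) (f : M → P)
    (x : M) : TangentSpace I x →L[ℝ] V :=
  (η.toFun (f x)).comp (mfderiv I 𝓘(ℝ, F) f x)

theorem OneForm.pullback_id_apply (η : OneForm F P V) (p : P) (v : TangentSpace 𝓘(ℝ, F) p) :
    η.pullback 𝓘(ℝ, F) id p v = η.toFun p v := by
  rw [pullback, mfderiv_id]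
  rfl

theorem OneForm.pullback_comp_apply (η : OneForm F P V) {g : M' → P} {f : M → M'} {x : M}
    (hg : MDifferentiableAt I' 𝓘(ℝ, F) g (f x)) (hf : MDifferentiableAt I I' f x)
    (v : TangentSpace I x) :
    η.pullback I (g ∘ f) x v = η.pullback I' g (f x) (mfderiv I I' f x v) :=
  congrArg (η.toFun (g (f x))) (mfderiv_comp_apply x hg hf v)

end Pullback

section PrincipalBundles

variable {E G V F P : Type*}
  [NormedAddCommGroup E] [NormedSpace ℝ E]
  [TopologicalSpace G] [ChartedSpace E G] [Group G] [LieGroup 𝓘(ℝ, E) ∞ G]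
  [NormedAddCommGroup V] [NormedSpace ℝ V]
  [NormedAddCommGroup F] [NormedSpace ℝ F]
  [TopologicalSpace P] [ChartedSpace F P] [IsManifold 𝓘(ℝ, F) ∞ P]
  {A : PfaffianGroup E G V} {θ : OneForm F P V}

theorem IsLeftPrincipalBundle.exists_orbit_diffeomorph [FiniteDimensional ℝ F] [MulAction G P]
    (h : IsLeftPrincipalBundle A θ) (p : P) :
    ∃ e : G ≃ₘ⟮𝓘(ℝ, E), 𝓘(ℝ, F)⟯ P, ∀ g, e g = g • p := by
  have : ContMDiffSMul 𝓘(ℝ, E) 𝓘(ℝ, F) ∞ G P := ⟨h.smooth_action⟩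
  have : ProperSMul G P := ⟨h.proper⟩
  have : MulAction.IsPretransitive G P := ⟨fun q r => (h.transitive q r).imp fun _ hg => hg.symm⟩
  have : IsCancelSMul G P := isCancelSMul_iff_eq_one_of_smul_eq.2 h.free
  exact exists_diffeomorph_eq_smul_const p

theorem IsLeftPrincipalBundle.pullback_smul_const_apply [MulAction G P]
    (h : IsLeftPrincipalBundle A θ) (p : P) (g : G) (v : TangentSpace 𝓘(ℝ, E) g) :
    θ.pullback 𝓘(ℝ, E) (fun x : G => x • p) g v = A.form.toFun g v := by
  have hcomp := θ.pullback_comp_apply (f := fun x : G => (x, p))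
    (h.smooth_action.mdifferentiableAt (by simp) (x := (g, p)))
    (mdifferentiableAt_id.prodMk mdifferentiableAt_const) v
  rw [mfderiv_prod_left] at hcomp
  refine (hcomp.trans (h.multiplicative g p v 0)).trans ?_
  rw [map_zero, map_zero, add_zero]

theorem IsRightPrincipalBundle.exists_orbit_diffeomorph [FiniteDimensional ℝ F]
    [MulAction Gᵐᵒᵖ P] (h : IsRightPrincipalBundle A θ) (p : P) :
    ∃ e : G ≃ₘ⟮𝓘(ℝ, E), 𝓘(ℝ, F)⟯ P, ∀ g, e g = MulOpposite.op g • p := by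
  have := topologicalGroup_of_lieGroup 𝓘(ℝ, E) ∞ (G := G)
  let inv : G ≃ₘ⟮𝓘(ℝ, E), 𝓘(ℝ, E)⟯ G :=
    ⟨Equiv.inv G, contMDiff_inv 𝓘(ℝ, E) ∞, contMDiff_inv 𝓘(ℝ, E) ∞⟩
  let _ : MulAction G P := .compHom P (MulEquiv.inv' G).toMonoidHom
  have hsmul : ∀ (g : G) (q : P), g • q = MulOpposite.op g⁻¹ • q := fun _ _ => rfl
  have : ContMDiffSMul 𝓘(ℝ, E) 𝓘(ℝ, F) ∞ G P :=
    ⟨h.smooth_action.comp (contMDiff_snd.prodMk (inv.contMDiff.comp contMDiff_fst))⟩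
  have : ProperSMul G P := ⟨h.proper.comp ((Homeomorph.prodComm G P).trans
    ((Homeomorph.refl P).prodCongr (Homeomorph.inv G))).isProperMap⟩
  have : MulAction.IsPretransitive G P := ⟨fun q r =>
    let ⟨g, hg⟩ := h.transitive q r
    ⟨g⁻¹, by rw [hsmul, inv_inv, hg]⟩⟩
  have : IsCancelSMul G P := isCancelSMul_iff_eq_one_of_smul_eq.2 fun g q hq =>
    inv_eq_one.1 (h.free q g⁻¹ hq)
  obtain ⟨e, he⟩ := exists_diffeomorph_eq_smul_const (E := E) (F := F) (G := G) p
  exact ⟨inv.trans e, fun g => (he g⁻¹).trans (by rw [hsmul, inv_inv])⟩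

theorem IsRightPrincipalBundle.contMDiff_op_smul_const [MulAction Gᵐᵒᵖ P]
    (h : IsRightPrincipalBundle A θ) (p : P) :
    ContMDiff 𝓘(ℝ, E) 𝓘(ℝ, F) ∞ fun g : G => MulOpposite.op g • p :=
  h.smooth_action.comp (contMDiff_const.prodMk contMDiff_id)

theorem IsRightPrincipalBundle.pullback_op_smul_const_apply [MulAction Gᵐᵒᵖ P]
    (h : IsRightPrincipalBundle A θ) (p : P) (g : G) (v : TangentSpace 𝓘(ℝ, E) g) :
    θ.pullback 𝓘(ℝ, E) (fun x : G => MulOpposite.op x • p) g v =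
      A.rep g⁻¹ (A.form.toFun g v) := by
  have hcomp := θ.pullback_comp_apply (f := fun x : G => (p, x))
    (h.smooth_action.mdifferentiableAt (by simp) (x := (p, g)))
    (mdifferentiableAt_const.prodMk mdifferentiableAt_id) v
  rw [mfderiv_prod_right] at hcomp
  refine (hcomp.trans (h.multiplicative p g 0 v)).trans ?_
  rw [map_zero, map_zero, zero_add]

end PrincipalBundles

section Equivalence

variable {E₁ G₁ V₁ E₂ G₂ V₂ : Type*}
  [NormedAddCommGroup E₁] [NormedSpace ℝ E₁]
  [TopologicalSpace G₁] [ChartedSpace E₁ G₁] [Group G₁] [LieGroup 𝓘(ℝ, E₁) ∞ G₁]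
  [NormedAddCommGroup V₁] [NormedSpace ℝ V₁]
  [NormedAddCommGroup E₂] [NormedSpace ℝ E₂]
  [TopologicalSpace G₂] [ChartedSpace E₂ G₂] [Group G₂] [LieGroup 𝓘(ℝ, E₂) ∞ G₂]
  [NormedAddCommGroup V₂] [NormedSpace ℝ V₂]
  {A : PfaffianGroup E₁ G₁ V₁} {B : PfaffianGroup E₂ G₂ V₂}

theorem PfaffianGroup.Hom.pfaffianIsomorphic (f : A.Hom B) (φ : G₁ ≃* G₂)
    (hφ : ∀ g, f.onGroup g = φ g) (hsymm : ContMDiff 𝓘(ℝ, E₂) 𝓘(ℝ, E₁) ∞ φ.symm)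
    (ψ : V₁ ≃ₗ[ℝ] V₂) (hψ : ∀ α, f.onRep α = ψ α) : PfaffianIsomorphic A B := by
  have hφ_symm : ∀ h, f.onGroup (φ.symm h) = h := fun h => by rw [hφ, φ.apply_symm_apply]
  have hpullback : ∀ (h : G₂) (w : TangentSpace 𝓘(ℝ, E₂) h),
      B.form.toFun h w = ψ (A.form.pullback 𝓘(ℝ, E₂) φ.symm h w) := fun h w => by
    rw [← B.form.pullback_id_apply, ← show f.onGroup ∘ φ.symm = id from funext hφ_symm,
      B.form.pullback_comp_apply (f.smooth_onGroup.mdifferentiableAt (by simp))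
        (hsymm.mdifferentiableAt (by simp)), ← hψ]
    exact f.pullback_form _ _
  let f' : B.Hom A :=
    { onGroup := φ.symm.toMonoidHom
      smooth_onGroup := hsymm
      onRep := ψ.symm.toLinearMap
      equivariant := fun h β => ψ.symm_apply_eq.2 <| by
        simpa [hψ, hφ_symm] using (f.equivariant (φ.symm h) (ψ.symm β)).symm
      pullback_form := fun h w => ψ.eq_symm_apply.2 (hpullback h w).symm }
  exact ⟨f, f', fun g => by simp [f', hφ], fun h => by simp [f', hφ],
    fun α => by simp [f', hψ], fun β => by simp [f', hψ]⟩

section OfBibundle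

variable {F P : Type*} [NormedAddCommGroup F] [NormedSpace ℝ F] [FiniteDimensional ℝ V₁]
  [TopologicalSpace P] [ChartedSpace F P] [IsManifold 𝓘(ℝ, F) ∞ P]
  [MulAction G₁ P] [MulAction G₂ᵐᵒᵖ P] {θ : OneForm F P V₁} {Φ : TrivialBundleIso F P V₁ V₂}

theorem IsPrincipalBibundle.exists_mulEquiv_smul_eq [FiniteDimensional ℝ F]
    (h : IsPrincipalBibundle A B θ Φ) (p : P) :
    ∃ φ : G₁ ≃* G₂, ContMDiff 𝓘(ℝ, E₁) 𝓘(ℝ, E₂) ∞ φ ∧ ContMDiff 𝓘(ℝ, E₂) 𝓘(ℝ, E₁) ∞ φ.symm ∧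
      ∀ g, MulOpposite.op (φ g) • p = g • p := by
  obtain ⟨e₁, he₁⟩ := h.left.exists_orbit_diffeomorph p
  obtain ⟨e₂, he₂⟩ := h.right.exists_orbit_diffeomorph p
  let e : G₁ ≃ₘ⟮𝓘(ℝ, E₁), 𝓘(ℝ, E₂)⟯ G₂ := e₁.trans e₂.symm
  have he : ∀ g, MulOpposite.op (e g) • p = g • p := fun g => by
    rw [← he₂, ← he₁]
    exact e₂.apply_symm_apply (e₁ g)
  have hmul : ∀ g g', e (g * g') = e g * e g' := fun g g' => e₂.injective <| by
    change e₂ (e (g * g')) = e₂ (e g * e g')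
    rw [he₂, he₂, he, MulOpposite.op_mul, mul_smul, mul_smul, he, h.commute, he]
  exact ⟨⟨e.toEquiv, hmul⟩, e.contMDiff, e.symm.contMDiff, he⟩

theorem IsPrincipalBibundle.rep_toFun_smul (h : IsPrincipalBibundle A B θ Φ) {p : P} {g : G₁}
    {k : G₂} (hk : MulOpposite.op k • p = g • p) (α : V₁) :
    B.rep k (Φ.toFun (g • p) α) = Φ.toFun p α := by
  rw [← hk, h.right_equivariant, Representation.self_inv_apply]

/-- The morphism with components `φ` and `Φ_p` defined by a base point `p` of a bibundle, where
`φ` is determined by `g · p = p · φ g`. -/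
def IsPrincipalBibundle.hom (h : IsPrincipalBibundle A B θ Φ) (p : P) (φ : G₁ →* G₂)
    (hφ : ContMDiff 𝓘(ℝ, E₁) 𝓘(ℝ, E₂) ∞ φ) (hp : ∀ g, MulOpposite.op (φ g) • p = g • p) :
    A.Hom B where
  onGroup := φ
  smooth_onGroup := hφ
  onRep := (Φ.toFun p).toLinearMap
  equivariant g α := by
    change Φ.toFun p (A.rep g α) = B.rep (φ g) (Φ.toFun p α)
    rw [← h.rep_toFun_smul (hp g), h.left_equivariant]
  pullback_form g v := by
    change B.form.pullback 𝓘(ℝ, E₁) φ g v = Φ.toFun p (A.form.toFun g v)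
    have hright : (Φ.compForm θ).pullback 𝓘(ℝ, E₁) (fun x => MulOpposite.op (φ x) • p) g v =
        B.rep (φ g)⁻¹ (B.form.pullback 𝓘(ℝ, E₁) φ g v) :=
      ((Φ.compForm θ).pullback_comp_apply
        ((h.right.contMDiff_op_smul_const p).mdifferentiableAt (by simp))
        (hφ.mdifferentiableAt (by simp)) v).trans (h.right.pullback_op_smul_const_apply p (φ g) _)
    have hleft : (Φ.compForm θ).pullback 𝓘(ℝ, E₁) (fun x : G₁ => x • p) g v =
        Φ.toFun (g • p) (A.form.toFun g v) :=
      congrArg (Φ.toFun (g • p)) (h.left.pullback_smul_const_apply p g v)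
    rw [← h.rep_toFun_smul (hp g), ← hleft, ← funext hp, hright, Representation.self_inv_apply]

theorem IsPrincipalBibundle.pfaffianIsomorphic [FiniteDimensional ℝ F]
    (h : IsPrincipalBibundle A B θ Φ) : PfaffianIsomorphic A B := by
  obtain ⟨p⟩ := h.left.nonempty
  obtain ⟨φ, hφ, hφ_symm, hp⟩ := h.exists_mulEquiv_smul_eq p
  exact (h.hom p φ.toMonoidHom hφ hp).pfaffianIsomorphic φ (fun _ => rfl) hφ_symm (Φ.toFun p)
    fun _ => rfl

end OfBibundle

theorem PfaffianGroup.isLeftPrincipalBundle_form (A : PfaffianGroup E₁ G₁ V₁) :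
    IsLeftPrincipalBundle A A.form := by
  have := topologicalGroup_of_lieGroup 𝓘(ℝ, E₁) ∞ (G := G₁)
  exact
    { nonempty := ⟨1⟩
      smooth_action := contMDiff_mul 𝓘(ℝ, E₁) ∞
      transitive := fun p q => ⟨q * p⁻¹, (inv_mul_cancel_right q p).symm⟩
      free := fun _ _ => mul_eq_right.1
      proper := ProperSMul.isProperMap_smul_pair
      multiplicative := A.multiplicative }

/-- The right action `p · h = p * f h` on `G₁` induced by a morphism `f` from a Pfaffian group
`G₂` to `G₁`. -/
abbrev PfaffianGroup.Hom.rightMulAction (f : B.Hom A) : MulAction G₂ᵐᵒᵖ G₁ :=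
  .compHom G₁ f.onGroup.op

theorem PfaffianGroup.Hom.contMDiff_mul_onGroup (f : B.Hom A) :
    ContMDiff (𝓘(ℝ, E₁).prod 𝓘(ℝ, E₂)) 𝓘(ℝ, E₁) ∞ fun x : G₁ × G₂ => x.1 * f.onGroup x.2 :=
  contMDiff_fst.mul (f.smooth_onGroup.comp contMDiff_snd)

theorem PfaffianGroup.Hom.pullback_mul_onGroup_apply (f : B.Hom A) (p : G₁) (h : G₂)
    (w : TangentSpace 𝓘(ℝ, E₁) p) (v : TangentSpace 𝓘(ℝ, E₂) h) :
    A.form.pullback (𝓘(ℝ, E₁).prod 𝓘(ℝ, E₂)) (fun x : G₁ × G₂ => x.1 * f.onGroup x.2) (p, h)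
      (w, v) = A.form.toFun p w + A.rep p (f.onRep (B.form.toFun h v)) := by
  have hf : MDifferentiableAt 𝓘(ℝ, E₂) 𝓘(ℝ, E₁) f.onGroup h :=
    f.smooth_onGroup.mdifferentiableAt (by simp)
  have hcomp := A.form.pullback_comp_apply (I := 𝓘(ℝ, E₁).prod 𝓘(ℝ, E₂))
    (f := Prod.map id f.onGroup) (x := (p, h))
    ((contMDiff_mul 𝓘(ℝ, E₁) ∞).mdifferentiableAt (by simp))
    (mdifferentiableAt_id.prodMap hf) (w, v)
  rw [mfderiv_prodMap mdifferentiableAt_id hf, mfderiv_id] at hcomp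
  rw [← f.pullback_form]
  exact hcomp.trans (A.multiplicative p (f.onGroup h) w _)

/-- The morphisms `f` and `f'` of Pfaffian groups are mutually inverse. -/
structure PfaffianGroup.Hom.IsInverse (f : A.Hom B) (f' : B.Hom A) : Prop where
  onGroup_left : ∀ g, f'.onGroup (f.onGroup g) = g
  onGroup_right : ∀ h, f.onGroup (f'.onGroup h) = h
  onRep_left : ∀ α, f'.onRep (f.onRep α) = α
  onRep_right : ∀ β, f.onRep (f'.onRep β) = β

variable {f : A.Hom B} {f' : B.Hom A}

theorem PfaffianGroup.Hom.IsInverse.isProperMap_mul_onGroup (hf : f.IsInverse f') :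
    IsProperMap fun x : G₁ × G₂ => (x.1 * f'.onGroup x.2, x.1) := by
  have := topologicalGroup_of_lieGroup 𝓘(ℝ, E₁) ∞ (G := G₁)
  let e : G₂ ≃ₜ G₁ :=
    { toFun := f'.onGroup
      invFun := f.onGroup
      left_inv := hf.onGroup_right
      right_inv := hf.onGroup_left
      continuous_toFun := f'.smooth_onGroup.continuous
      continuous_invFun := f.smooth_onGroup.continuous }
  exact ((Homeomorph.refl G₁).prodCongr e |>.trans (Homeomorph.shearMulRight G₁)
    |>.trans (Homeomorph.prodComm G₁ G₁)).isProperMap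

/-- The isomorphism of trivial bundles over `G₁` with fibre maps `α ↦ f (p⁻¹ · α)`, the fibre
isomorphism of the bibundle attached to a pair of mutually inverse morphisms. -/
noncomputable def PfaffianGroup.Hom.IsInverse.trivialBundleIso [FiniteDimensional ℝ V₁]
    (hf : f.IsInverse f') : TrivialBundleIso E₁ G₁ V₁ V₂ where
  toFun p := LinearEquiv.ofLinearMap (f.onRep ∘ₗ A.rep p⁻¹) (A.rep p ∘ₗ f'.onRep)
    (LinearMap.ext fun β => by simp [hf.onRep_right])
    (LinearMap.ext fun α => by simp [hf.onRep_left])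
  smooth := (LinearMap.toContinuousLinearMap f.onRep).contMDiff.comp
    (A.smooth_rep.comp (((contMDiff_inv 𝓘(ℝ, E₁) ∞).comp contMDiff_fst).prodMk contMDiff_snd))

variable [FiniteDimensional ℝ V₁]

theorem PfaffianGroup.Hom.IsInverse.trivialBundleIso_toFun_smul (hf : f.IsInverse f') (g p : G₁)
    (α : V₁) :
    hf.trivialBundleIso.toFun (g * p) (A.rep g α) = hf.trivialBundleIso.toFun p α := by
  change f.onRep (A.rep (g * p)⁻¹ (A.rep g α)) = f.onRep (A.rep p⁻¹ α)
  rw [mul_inv_rev, map_mul, Module.End.mul_apply, Representation.inv_self_apply]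

theorem PfaffianGroup.Hom.IsInverse.trivialBundleIso_toFun_mul_onGroup (hf : f.IsInverse f')
    (p : G₁) (h : G₂) (α : V₁) :
    hf.trivialBundleIso.toFun (p * f'.onGroup h) α =
      B.rep h⁻¹ (hf.trivialBundleIso.toFun p α) := by
  change f.onRep (A.rep (p * f'.onGroup h)⁻¹ α) = B.rep h⁻¹ (f.onRep (A.rep p⁻¹ α))
  rw [mul_inv_rev, map_mul, Module.End.mul_apply, f.equivariant, map_inv, hf.onGroup_right]

theorem PfaffianGroup.Hom.IsInverse.trivialBundleIso_toFun_rep (hf : f.IsInverse f') (p : G₁)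
    (β : V₂) : hf.trivialBundleIso.toFun p (A.rep p (f'.onRep β)) = β :=
  (hf.trivialBundleIso.toFun p).apply_symm_apply β

theorem PfaffianGroup.Hom.IsInverse.isRightPrincipalBundle_compForm (hf : f.IsInverse f') :
    letI := f'.rightMulAction
    IsRightPrincipalBundle B (hf.trivialBundleIso.compForm A.form) := by
  let _ := f'.rightMulAction
  have hop : ∀ (p : G₁) (h : G₂), MulOpposite.op h • p = p * f'.onGroup h := fun _ _ => rfl
  exact
    { nonempty := ⟨1⟩
      smooth_action := f'.contMDiff_mul_onGroup
      transitive := fun p q =>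
        ⟨f.onGroup (p⁻¹ * q), by rw [hop, hf.onGroup_left, mul_inv_cancel_left]⟩
      free := fun p h hp => by
        rw [hop, mul_eq_left] at hp
        rw [← hf.onGroup_right h, hp, map_one]
      proper := hf.isProperMap_mul_onGroup
      multiplicative := fun p h w v => by
        refine (congrArg (hf.trivialBundleIso.toFun (p * f'.onGroup h))
          (f'.pullback_mul_onGroup_apply p h w v)).trans ?_
        rw [hf.trivialBundleIso_toFun_mul_onGroup, map_add, map_add,
          hf.trivialBundleIso_toFun_rep]
        rfl }

theorem PfaffianGroup.Hom.IsInverse.isPrincipalBibundle (hf : f.IsInverse f') :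
    letI := f'.rightMulAction
    IsPrincipalBibundle A B A.form hf.trivialBundleIso :=
  letI := f'.rightMulAction
  { left := A.isLeftPrincipalBundle_form
    right := hf.isRightPrincipalBundle_compForm
    commute := fun g h p => mul_assoc g p (f'.onGroup h)
    left_equivariant := hf.trivialBundleIso_toFun_smul
    right_equivariant := hf.trivialBundleIso_toFun_mul_onGroup }

end Equivalence

end Pfaffian

theorem mainTheorem5_general {E₁ E₂ : Type u} {G₁ G₂ : Type v} {V₁ V₂ : Type*}
    [NormedAddCommGroup E₁] [NormedSpace ℝ E₁] [FiniteDimensional ℝ E₁]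
    [TopologicalSpace G₁] [T2Space G₁] [ChartedSpace E₁ G₁] [Group G₁] [LieGroup 𝓘(ℝ, E₁) ∞ G₁]
    [NormedAddCommGroup V₁] [NormedSpace ℝ V₁] [FiniteDimensional ℝ V₁]
    [NormedAddCommGroup E₂] [NormedSpace ℝ E₂]
    [TopologicalSpace G₂] [ChartedSpace E₂ G₂] [Group G₂] [LieGroup 𝓘(ℝ, E₂) ∞ G₂]
    [NormedAddCommGroup V₂] [NormedSpace ℝ V₂]
    (A : Pfaffian.PfaffianGroup E₁ G₁ V₁) (B : Pfaffian.PfaffianGroup E₂ G₂ V₂) :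
    Pfaffian.PfaffianMoritaEquivalent A B ↔ Pfaffian.PfaffianIsomorphic A B := by
  constructor
  · rintro ⟨F, _, _, _, P, _, _, _, _, _, _, θ, Φ, h⟩
    exact h.pfaffianIsomorphic
  · rintro ⟨f, f', hgl, hgr, hrl, hrr⟩
    have hf : f.IsInverse f' := ⟨hgl, hgr, hrl, hrr⟩
    exact ⟨E₁, _, _, inferInstance, G₁, _, inferInstance, _, inferInstance, _, f'.rightMulAction,
      A.form, hf.trivialBundleIso, hf.isPrincipalBibundle⟩

theorem mainTheorem5 {E₁ E₂ : Type u} {G₁ G₂ : Type v} {V₁ V₂ : Type*}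
    [NormedAddCommGroup E₁] [NormedSpace ℝ E₁] [FiniteDimensional ℝ E₁]
    [TopologicalSpace G₁] [T2Space G₁] [ChartedSpace E₁ G₁] [Group G₁] [LieGroup 𝓘(ℝ, E₁) ∞ G₁]
    [NormedAddCommGroup V₁] [NormedSpace ℝ V₁] [FiniteDimensional ℝ V₁]
    [NormedAddCommGroup E₂] [NormedSpace ℝ E₂] [FiniteDimensional ℝ E₂]
    [TopologicalSpace G₂] [T2Space G₂] [ChartedSpace E₂ G₂] [Group G₂] [LieGroup 𝓘(ℝ, E₂) ∞ G₂]
    [NormedAddCommGroup V₂] [NormedSpace ℝ V₂] [FiniteDimensional ℝ V₂]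
    (A : Pfaffian.PfaffianGroup E₁ G₁ V₁) (B : Pfaffian.PfaffianGroup E₂ G₂ V₂) :
    Pfaffian.PfaffianMoritaEquivalent A B ↔ Pfaffian.PfaffianIsomorphic A B :=
  mainTheorem5_general A B
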